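/- (i) Let $X$ be a countable torsion-free discrete Abelian group, let $\alpha$ be an automorphism of $X$, and let $I$ be the identity automorphism. Assume that $\operatorname{Ker}(I+\alpha)=\{0\}$. Let $\xi_1$ and $\xi_2$ be independent random variables with values in $X$ and distributions $\mu_1$ and $\mu_2$. If the conditional distribution of the linear form $L_2=\xi_1+\alpha\xi_2$ given $L_1=\xi_1+\xi_2$ is symmetric (that is, for almost every value of $L_1$, it is invariant under $x\mapsto -x$), then $\mu_1$ and $\mu_2$ are degenerate distributions, i.e. each of them is concentrated at one point. (ii) (Dual formulation.) Let $Y$ be a second countable connected compact Abelian group and let $X$ be its character group; write $(x,y)$ for the value of the character $x\in X$ at $y\in Y$. Let $\tilde\alpha$ be a topological automorphism of $Y$ with $(I+\tilde\alpha)(Y)=Y$, where $I$ is the identity automorphism. Let $\mu_1,\mu_2$ be probability distributions on $X$, and let $\hat\mu_j(y)=\int_X (x,y)\,d\mu_j(x)$ be their characteristic functions. If $$\hat\mu_1(u+v)\,\hat\mu_2(u+\tilde\alpha v)=\hat\mu_1(u-v)\,\hat\mu_2(u-\tilde\alpha v)\qquad\text{for all }u,v\in Y,$$ then there are $x_1,x_2\in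 X$ such that $\hat\mu_j(y)=(x_j,y)$ for all $y\in Y$, $j=1,2$. -/

import Mathlib

open MeasureTheory ProbabilityTheory

/-- The conditional distribution of `L₂` given `L₁` is symmetric: for almost every value `s` of `L₁`
(with respect to the law of `L₁`), the regular conditional distribution of `L₂` given `L₁ = s` is
invariant under `t ↦ -t`. -/
def CondDistribSymmetric {Ω S T : Type*} [MeasurableSpace Ω] [MeasurableSpace S]
    [MeasurableSpace T] [StandardBorelSpace T] [AddGroup T]
    (P : Measure Ω) [IsFiniteMeasure P] (L₂ : Ω → T) (L₁ : Ω → S) : Prop :=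
  ∀ᵐ s ∂(P.map L₁), (condDistrib L₂ L₁ P s).map (fun t => -t) = condDistrib L₂ L₁ P s

/-- A distribution is degenerate if it is concentrated at one point. -/
def IsDegenerate {X : Type*} [MeasurableSpace X] (μ : Measure X) : Prop :=
  ∃ x : X, μ = Measure.dirac x

/-- The character group of an additive topological group `Y`: the continuous homomorphisms from `Y`
to the circle group, with the compact-open topology. -/
abbrev CharGroup (Y : Type*) [AddCommGroup Y] [TopologicalSpace Y] : Type _ :=
  PontryaginDual (Multiplicative Y)

/-- The value `(x, y)` of the character `x` at `y`, as a complex number of modulus one. -/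
noncomputable def charValue {Y : Type*} [AddCommGroup Y] [TopologicalSpace Y] (x : CharGroup Y) (y : Y) : ℂ :=
  ((x (Multiplicative.ofAdd y) : Circle) : ℂ)

/-- The characteristic function `y ↦ ∫ (x, y) dμ(x)` of a distribution `μ` on the character group
of `Y`. -/
noncomputable def charFunction {Y : Type*} [AddCommGroup Y] [TopologicalSpace Y]
    [MeasurableSpace (CharGroup Y)] (μ : Measure (CharGroup Y)) (y : Y) : ℂ :=
  ∫ x, charValue x y ∂μ

open scoped ENNReal

/-! Everything reduces to `HeydeSymm`, an identity between laws on `X × X`. It survives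
symmetrization, and a symmetrized law on a torsion-free group has its strictly largest atom at `0`.
So it suffices that the symmetrization of `μ` has no atom at any `d ≠ 0`.

Put `δ = α - 1`. The outcome `(d, 0)` gives both forms the value `d`; by symmetry this weight is at
most that of the solutions of `x + y = d`, `x + α y = -d`, for which `δ y = -2d` and `δ x = (α + 1)
d`. If `δ` is injective there is at most one solution, and for `d` the heaviest nonzero atom its
weight is too small (`HeydeSymm.singleton_eq_zero_of_injective`). In general, dividing by the union
of the kernels of the powers of `δ` makes `δ` injective, so the mass sits on that union. There the
same inequality pushes mass up the levels of the filtration, which summability forbids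
(`HeydeSymm.measure_kerLevel_eq_zero`).

The second law follows by exchanging the variables and replacing `α` with its inverse. The dual form
is the same identity read through Fourier transforms. -/

/-- The law of `(x + y, x + α y)` under `μ ⊗ ν` is invariant under `(s, t) ↦ (s, -t)`. -/
def HeydeSymm {X : Type*} [AddCommGroup X] [MeasurableSpace X] (α : X →+ X)
    (μ ν : Measure X) : Prop :=
  (μ.prod ν).map (fun p => (p.1 + p.2, p.1 + α p.2)) =
    (μ.prod ν).map (fun p => (p.1 + p.2, -(p.1 + α p.2)))

/-- The law of the difference of two independent variables with distribution `μ`. -/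
noncomputable def symmetrization {X : Type*} [AddCommGroup X] [MeasurableSpace X]
    (μ : Measure X) : Measure X :=
  (μ.prod μ).map (fun p => p.1 - p.2)

/-! ### Autocorrelation of summable functions. -/

section Shift

variable {X : Type*} [AddCommGroup X] {p : X → ℝ} {b : X}

/-- Equality case of Cauchy–Schwarz: `∑ (p (x - b) - p x) ^ 2` expands to twice the difference of
the two sums, hence is at most `0`. -/
lemma shift_eq_of_tsum_shift_mul_le (hp : ∀ x, 0 ≤ p x) (hs : Summable p)
    (hle : ∑' x, p x * p x ≤ ∑' x, p (x - b) * p x) (x : X) : p (x - b) = p x := by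
  obtain ⟨C, hC⟩ : ∃ C, ∀ x, p x ≤ C := ⟨∑' x, p x, fun x => hs.le_tsum x fun y _ => hp y⟩
  have h1 : Summable fun x => p x * p x :=
    Summable.of_nonneg_of_le (fun x => mul_nonneg (hp x) (hp x))
      (fun x => mul_le_mul_of_nonneg_right (hC x) (hp x)) (hs.mul_left C)
  have h2 : Summable fun x => p (x - b) * p x :=
    Summable.of_nonneg_of_le (fun x => mul_nonneg (hp _) (hp x))
      (fun x => mul_le_mul_of_nonneg_right (hC _) (hp x)) (hs.mul_left C)
  have h3 : Summable fun x => p (x - b) * p (x - b) :=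
    (Equiv.subRight b).summable_iff (f := fun x => p x * p x) |>.2 h1
  have h4 : ∑' x, p (x - b) * p (x - b) = ∑' x, p x * p x :=
    (Equiv.subRight b).tsum_eq (fun x => p x * p x)
  have hsum : HasSum (fun x => (p (x - b) - p x) ^ 2)
      (∑' x, p x * p x + ∑' x, p x * p x - 2 * ∑' x, p (x - b) * p x) := by
    have := ((h4 ▸ h3.hasSum).add h1.hasSum).sub (h2.hasSum.mul_left 2)
    refine this.congr_fun ?_
    intro x
    ring
  have hx := le_hasSum hsum x fun _ _ => sq_nonneg _
  have h0 : (p (x - b) - p x) ^ 2 = 0 := le_antisymm (by linarith) (sq_nonneg _)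
  exact sub_eq_zero.1 ((pow_eq_zero_iff two_ne_zero).1 h0)

/-- `p` is constant along the points `x + n • b`, which are infinitely many by torsion-freeness, so
summability forces the constant to be `0`. -/
lemma eq_zero_of_tsum_shift_mul_le [IsAddTorsionFree X] (hp : ∀ x, 0 ≤ p x) (hs : Summable p)
    (hb : b ≠ 0) (hle : ∑' x, p x * p x ≤ ∑' x, p (x - b) * p x) (x : X) : p x = 0 := by
  have heq := shift_eq_of_tsum_shift_mul_le hp hs hle
  have hconst : ∀ n : ℕ, p (x + n • b) = p x := by
    intro n
    induction n with
    | zero => simp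
    | succ n ih =>
      rw [← ih, ← heq (x + (n + 1) • b), succ_nsmul]
      congr 1
      abel
  have := (hs.comp_injective
    ((add_right_injective x).comp (injective_nsmul_iff_not_isOfFinAddOrder.2
      (not_isOfFinAddOrder_of_isAddTorsionFree hb)))).tendsto_cofinite_zero
  simp only [Function.comp_def, hconst] at this
  exact tendsto_nhds_unique tendsto_const_nhds this

end Shift

/-! ### Symmetrized distributions and their atoms. -/

section Symmetrization

variable {X : Type*} [AddCommGroup X] [Countable X] [MeasurableSpace X]
  [DiscreteMeasurableSpace X]

instance isProbabilityMeasure_symmetrization (μ : Measure X) [IsProbabilityMeasure μ] :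
    IsProbabilityMeasure (symmetrization μ) :=
  Measure.isProbabilityMeasure_map (Measurable.of_discrete).aemeasurable

lemma lintegral_symmetrization (μ : Measure X) [IsProbabilityMeasure μ] (f : X → ℝ≥0∞) :
    ∫⁻ x, f x ∂(symmetrization μ) = ∫⁻ x, ∫⁻ x', f (x - x') ∂μ ∂μ := by
  rw [symmetrization, lintegral_map .of_discrete .of_discrete, lintegral_prod _ (by fun_prop)]

lemma symmetrization_map {Z : Type*} [AddCommGroup Z] [Countable Z] [MeasurableSpace Z]
    [DiscreteMeasurableSpace Z] (f : X →+ Z) (μ : Measure X) [IsProbabilityMeasure μ] :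
    symmetrization (μ.map f) = (symmetrization μ).map f := by
  have : IsProbabilityMeasure (μ.map f) :=
    Measure.isProbabilityMeasure_map (Measurable.of_discrete).aemeasurable
  refine Measure.ext_of_lintegral _ fun g _ => ?_
  rw [lintegral_symmetrization, lintegral_map .of_discrete .of_discrete,
    lintegral_map .of_discrete .of_discrete, lintegral_symmetrization]
  refine lintegral_congr fun x => ?_
  rw [lintegral_map .of_discrete .of_discrete]
  simp

lemma symmetrization_singleton (μ : Measure X) [IsProbabilityMeasure μ] (b : X) :
    symmetrization μ {b} = ∫⁻ x, μ {x - b} ∂μ := by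
  rw [symmetrization, Measure.map_apply .of_discrete .of_discrete,
    Measure.prod_apply .of_discrete]
  refine lintegral_congr fun x => ?_
  congr 1
  ext y
  simp only [Set.mem_preimage, Set.mem_singleton_iff]
  constructor
  · rintro rfl; abel
  · rintro rfl; abel

lemma symmetrization_real_singleton (μ : Measure X) [IsProbabilityMeasure μ] (b : X) :
    (symmetrization μ).real {b} = ∑' x, μ.real {x - b} * μ.real {x} := by
  rw [measureReal_def, symmetrization_singleton, lintegral_countable',
    ENNReal.tsum_toReal_eq (fun x => by finiteness)]
  simp [measureReal_def]

omit [AddCommGroup X] in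
lemma tsum_measure_singleton (μ : Measure X) [IsProbabilityMeasure μ] :
    ∑' x, μ {x} = 1 := by
  have := lintegral_countable' (μ := μ) (fun _ => (1 : ℝ≥0∞))
  simpa using this.symm

omit [AddCommGroup X] in
lemma summable_real_singleton (μ : Measure X) [IsProbabilityMeasure μ] :
    Summable fun x => μ.real {x} := by
  refine ENNReal.summable_toReal ?_
  rw [tsum_measure_singleton μ]
  finiteness

lemma symmetrization_singleton_lt [IsAddTorsionFree X] (μ : Measure X) [IsProbabilityMeasure μ]
    {b : X} (hb : b ≠ 0) : symmetrization μ {b} < symmetrization μ {0} := by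
  rw [← ENNReal.toReal_lt_toReal (by finiteness) (by finiteness), ← measureReal_def,
    ← measureReal_def, symmetrization_real_singleton, symmetrization_real_singleton]
  simp only [sub_zero]
  by_contra! hle
  have hzero := eq_zero_of_tsum_shift_mul_le (fun x => measureReal_nonneg)
    (summable_real_singleton μ) hb hle
  have hsing : ∀ x, μ {x} = 0 := fun x => (measureReal_eq_zero_iff (by finiteness)).1 (hzero x)
  have := tsum_measure_singleton μ
  simp [hsing] at this

/-- The mass at `0` is the `μ`-average of `μ {x}`; an average of `1` needs an atom of mass `1`. -/
lemma exists_eq_dirac_of_symmetrization (μ : Measure X) [IsProbabilityMeasure μ]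
    (h : symmetrization μ {0} = 1) : ∃ x, μ = Measure.dirac x := by
  rw [symmetrization_singleton] at h
  have hx : ∃ x, μ {x} = 1 := by
    by_contra! hne
    have hlt : ∀ x, μ {x} < 1 := fun x => lt_of_le_of_ne prob_le_one (hne x)
    have : ∫⁻ x, μ {x - 0} ∂μ < ∫⁻ _, 1 ∂μ :=
      lintegral_strict_mono (IsProbabilityMeasure.ne_zero μ) (by fun_prop)
        (by rw [h]; simp) (Filter.Eventually.of_forall fun x => by simpa using hlt x)
    simp only [h, lintegral_one, measure_univ, lt_self_iff_false] at this
  obtain ⟨x, hx⟩ := hx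
  refine ⟨x, ?_⟩
  have hae : ∀ᵐ y ∂μ, y = x := by
    have := (prob_compl_eq_zero_iff (μ := μ) (s := {x}) .of_discrete).2 hx
    exact this
  have : μ.map id = μ.map fun _ => x := Measure.map_congr hae
  rwa [Measure.map_id, Measure.map_const, measure_univ, one_smul] at this

end Symmetrization

/-! ### Stability of the symmetry identity. -/

section HeydeSymm

variable {X : Type*} [AddCommGroup X] [Countable X] [MeasurableSpace X]
  [DiscreteMeasurableSpace X] {α : X →+ X} {μ ν : Measure X}

lemma HeydeSymm.measure_eq (h : HeydeSymm α μ ν) (S : Set (X × X)) :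
    (μ.prod ν) {p | (p.1 + p.2, p.1 + α p.2) ∈ S} =
      (μ.prod ν) {p | (p.1 + p.2, -(p.1 + α p.2)) ∈ S} := by
  have := congrArg (fun m => m S) h
  rwa [Measure.map_apply .of_discrete .of_discrete,
    Measure.map_apply .of_discrete .of_discrete] at this

lemma heydeSymm_iff_lintegral [IsProbabilityMeasure μ] [IsProbabilityMeasure ν] :
    HeydeSymm α μ ν ↔ ∀ f : X × X → ℝ≥0∞,
      ∫⁻ x, ∫⁻ y, f (x + y, x + α y) ∂ν ∂μ = ∫⁻ x, ∫⁻ y, f (x + y, -(x + α y)) ∂ν ∂μ := by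
  have key : ∀ (g : X × X → X × X) (f : X × X → ℝ≥0∞),
      ∫⁻ q, f q ∂((μ.prod ν).map g) = ∫⁻ x, ∫⁻ y, f (g (x, y)) ∂ν ∂μ := fun g f => by
    rw [lintegral_map .of_discrete .of_discrete, lintegral_prod _ (by fun_prop)]
  constructor
  · intro h f
    rw [← key (fun p => (p.1 + p.2, p.1 + α p.2)), ← key (fun p => (p.1 + p.2, -(p.1 + α p.2))),
      show (μ.prod ν).map _ = _ from h]
  · intro h
    refine Measure.ext_of_lintegral _ fun f _ => ?_
    rw [key, key]
    exact h f

lemma HeydeSymm.symmetrized [IsProbabilityMeasure μ] [IsProbabilityMeasure ν]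
    (h : HeydeSymm α μ ν) : HeydeSymm α (symmetrization μ) (symmetrization ν) := by
  rw [heydeSymm_iff_lintegral] at h ⊢
  intro f
  have expand : ∀ g : X → X → ℝ≥0∞,
      ∫⁻ x, ∫⁻ y, g x y ∂(symmetrization ν) ∂(symmetrization μ) =
        ∫⁻ x, ∫⁻ y, ∫⁻ x', ∫⁻ y', g (x - x') (y - y') ∂ν ∂μ ∂ν ∂μ := by
    intro g
    simp_rw [lintegral_symmetrization]
    refine lintegral_congr fun x => ?_
    exact lintegral_lintegral_swap (by fun_prop)
  rw [expand, expand]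
  have e1 : ∀ x y x' y' : X, x - x' + (y - y') = (x + y) - (x' + y') := fun _ _ _ _ => by abel
  have e2 : ∀ x y x' y' : X, x - x' + α (y - y') = (x + α y) - (x' + α y') :=
    fun _ _ _ _ => by rw [map_sub]; abel
  simp_rw [e1, e2]
  -- The identity is used once for each of the two independent copies: here for `(x, y)`, then for
  -- `(x', y')` with `(x, y)` fixed.
  rw [h fun s => ∫⁻ x', ∫⁻ y', f (s.1 - (x' + y'), s.2 - (x' + α y')) ∂ν ∂μ]
  refine lintegral_congr fun x => lintegral_congr fun y => ?_
  dsimp only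
  rw [h fun s => f (x + y - s.1, -(x + α y) - s.2)]
  refine lintegral_congr fun x' => lintegral_congr fun y' => ?_
  dsimp only
  congr 2
  abel

lemma HeydeSymm.map {Z : Type*} [AddCommGroup Z] [Countable Z] [MeasurableSpace Z]
    [DiscreteMeasurableSpace Z] [IsProbabilityMeasure μ] [IsProbabilityMeasure ν]
    (h : HeydeSymm α μ ν) (π : X →+ Z) {β : Z →+ Z} (hβ : ∀ x, β (π x) = π (α x)) :
    HeydeSymm β (μ.map π) (ν.map π) := by
  have : IsProbabilityMeasure (μ.map π) :=
    Measure.isProbabilityMeasure_map (Measurable.of_discrete).aemeasurable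
  have : IsProbabilityMeasure (ν.map π) :=
    Measure.isProbabilityMeasure_map (Measurable.of_discrete).aemeasurable
  rw [heydeSymm_iff_lintegral] at h ⊢
  intro f
  have key : ∀ g : Z → Z → ℝ≥0∞,
      ∫⁻ z, ∫⁻ w, g z w ∂(ν.map π) ∂(μ.map π) = ∫⁻ x, ∫⁻ y, g (π x) (π y) ∂ν ∂μ := fun g => by
    rw [lintegral_map .of_discrete .of_discrete]
    exact lintegral_congr fun x => lintegral_map .of_discrete .of_discrete
  rw [key, key]
  simpa only [hβ, map_add, map_neg] using h fun q => f (π q.1, π q.2)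

/-- `x + α y = α (y + α⁻¹ x)`, and `α⁻¹` commutes with negation. -/
lemma HeydeSymm.swap [IsProbabilityMeasure μ] [IsProbabilityMeasure ν] (α : X ≃+ X)
    (h : HeydeSymm (α : X →+ X) μ ν) : HeydeSymm (α.symm : X →+ X) ν μ := by
  rw [heydeSymm_iff_lintegral] at h ⊢
  intro f
  have := h fun q => f (q.1, α.symm q.2)
  rw [lintegral_lintegral_swap (f := fun y x => f (y + x, y + (α.symm : X →+ X) x)) (by fun_prop),
    lintegral_lintegral_swap (f := fun y x => f (y + x, -(y + (α.symm : X →+ X) x)))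
      (by fun_prop)]
  simpa [add_comm] using this

end HeydeSymm

/-! ### The filtration by kernels of powers of an endomorphism. -/

section KerLevel

variable {X : Type*} [AddCommGroup X]

/-- If `x + y = d` and `x + α y = -d`, then `(α - 1) y = -2 d` and `(α - 1) x = (α + 1) d`. -/
lemma sub_apply_of_antidiagonal {α : X →+ X} {x y d : X} (h₁ : x + y = d) (h₂ : -(x + α y) = d) :
    α y - y = -(2 • d) ∧ α x - x = α d + d := by
  have h₂' : x + α y = -d := by rw [← h₂, neg_neg]
  constructor
  · rw [two_nsmul, neg_add]
    nth_rw 1 [← h₂']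
    rw [← h₁]; abel
  · have : α y = -d - x := by rw [← h₂']; abel
    have hx : α x = α d - α y := by rw [← map_sub, ← h₁]; simp
    rw [hx, this]; abel

/-- The elements killed by the `(n+1)`-st but not by the `n`-th power of `δ`. -/
def kerLevel (δ : X →+ X) (n : ℕ) : Set X := {x | δ^[n + 1] x = 0 ∧ δ^[n] x ≠ 0}

lemma disjoint_kerLevel (δ : X →+ X) : Pairwise (Function.onFun Disjoint (kerLevel δ)) := by
  have key : ∀ m n : ℕ, m < n → Disjoint (kerLevel δ m) (kerLevel δ n) := by
    intro m n hmn
    rw [Set.disjoint_left]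
    rintro x ⟨hx, -⟩ ⟨-, hx'⟩
    apply hx'
    obtain ⟨k, rfl⟩ := Nat.exists_eq_add_of_le hmn
    rw [show m.succ + k = k + (m + 1) by omega, Function.iterate_add_apply, hx, iterate_map_zero]
  intro m n hmn
  rcases lt_or_gt_of_ne hmn with h | h
  · exact key _ _ h
  · exact (key _ _ h).symm

lemma mem_kerLevel_succ {δ : X →+ X} {n : ℕ} {x : X} :
    x ∈ kerLevel δ (n + 1) ↔ δ x ∈ kerLevel δ n := Iff.rfl

lemma exists_mem_kerLevel {δ : X →+ X} {n : ℕ} {x : X} (hx : δ^[n] x = 0) (hx0 : x ≠ 0) :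
    ∃ m, x ∈ kerLevel δ m := by
  induction n with
  | zero => exact absurd hx hx0
  | succ n ih =>
    by_cases h : δ^[n] x = 0
    · exact ih h
    · exact ⟨n, hx, h⟩

/-- The elements killed by some power of `δ`. -/
def kerUnion (δ : X →+ X) : AddSubgroup X where
  carrier := {x | ∃ n : ℕ, δ^[n] x = 0}
  zero_mem' := ⟨0, rfl⟩
  add_mem' := by
    rintro x y ⟨m, hm⟩ ⟨n, hn⟩
    refine ⟨m + n, ?_⟩
    rw [iterate_map_add, add_comm m n, Function.iterate_add_apply, hm, add_comm n m,
      Function.iterate_add_apply, hn]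
    simp
  neg_mem' := by
    rintro x ⟨m, hm⟩
    exact ⟨m, by rw [iterate_map_neg, hm, neg_zero]⟩

lemma isAddTorsionFree_quotient_kerUnion [IsAddTorsionFree X] (δ : X →+ X) :
    IsAddTorsionFree (X ⧸ kerUnion δ) where
  nsmul_right_injective n hn := by
    intro a b
    induction a using QuotientAddGroup.induction_on with | H a => ?_
    induction b using QuotientAddGroup.induction_on with | H b => ?_
    intro hab
    have hab' : ((n • a : X) : X ⧸ kerUnion δ) = ((n • b : X) : X ⧸ kerUnion δ) := hab
    rw [QuotientAddGroup.eq] at hab' ⊢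
    obtain ⟨m, hm⟩ := hab'
    refine ⟨m, ?_⟩
    rw [← neg_nsmul, ← nsmul_add, iterate_map_nsmul] at hm
    exact (nsmul_eq_zero_iff_right hn).1 hm

end KerLevel

/-! ### Vanishing of the nonzero atoms. -/

section Degeneracy

variable {X : Type*} [AddCommGroup X] [Countable X] [MeasurableSpace X]
  [DiscreteMeasurableSpace X] {α : X →+ X} {μ ν : Measure X}

omit [Countable X] in
-- Only finitely many points weigh at least `μ {d}`.
lemma exists_max_singleton [IsFiniteMeasure μ] {d : X} (hd : d ≠ 0) (hμ : μ {d} ≠ 0) :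
    ∃ z, z ≠ 0 ∧ μ {z} ≠ 0 ∧ ∀ w, w ≠ 0 → μ {w} ≤ μ {z} := by
  have hfin : {x : X | μ {d} ≤ μ {x}}.Finite :=
    Measure.finite_const_le_meas_of_disjoint_iUnion μ (pos_iff_ne_zero.2 hμ)
      (fun x => .of_discrete) (fun x y hxy => by simpa using hxy) (by finiteness)
  obtain ⟨z, hz, hmax⟩ := Set.exists_max_image _ (fun x => μ {x})
    (hfin.inter_of_left {x | x ≠ 0}) ⟨d, le_refl (μ {d}), hd⟩
  refine ⟨z, hz.2, fun h0 => hμ (le_antisymm (h0 ▸ hz.1) zero_le), fun w hw => ?_⟩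
  by_cases h : μ {d} ≤ μ {w}
  · exact hmax w ⟨h, hw⟩
  · exact (not_le.1 h).le.trans hz.1

lemma HeydeSymm.singleton_eq_zero_of_injective [IsAddTorsionFree X] [IsProbabilityMeasure μ]
    [IsProbabilityMeasure ν] (h : HeydeSymm α μ ν) (hα : ∀ x, x + α x = 0 → x = 0)
    (hδ : ∀ x, α x - x = 0 → x = 0) (hν : ∀ b, b ≠ 0 → ν {b} < ν {0}) {d : X} (hd : d ≠ 0) :
    μ {d} = 0 := by
  by_contra hμ
  obtain ⟨z, hz, hμz, hmax⟩ := exists_max_singleton hd hμ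
  have hle : μ {z} * ν {0} ≤ (μ.prod ν) {p | (p.1 + p.2, -(p.1 + α p.2)) ∈ ({(z, z)} : Set _)} := by
    rw [← h.measure_eq, ← Measure.prod_prod]
    refine measure_mono ?_
    rintro ⟨x, y⟩ ⟨hx, hy⟩
    simp only [Set.mem_singleton_iff] at hx hy
    simp [hx, hy]
  by_cases hex : ∃ p : X × X, p.1 + p.2 = z ∧ -(p.1 + α p.2) = z
  · obtain ⟨⟨a, b⟩, ha, hb⟩ := hex
    obtain ⟨hb', ha'⟩ := sub_apply_of_antidiagonal ha hb
    -- `b = 0` would give `2z = 0`, and `a = 0` would put `z` in `Ker (I + α)`.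
    have hb0 : b ≠ 0 := by
      rintro rfl
      simp [hz] at hb'
    have ha0 : a ≠ 0 := by
      rintro rfl
      exact hz (hα z (by rw [add_comm]; simpa using ha'.symm))
    have hsub : {p : X × X | (p.1 + p.2, -(p.1 + α p.2)) ∈ ({(z, z)} : Set _)} ⊆ {a} ×ˢ {b} := by
      rintro ⟨x, y⟩ hp
      simp only [Set.mem_ofPred_eq, Set.mem_singleton_iff, Prod.mk.injEq] at hp
      obtain ⟨hy', hx'⟩ := sub_apply_of_antidiagonal hp.1 hp.2
      -- Two solutions differ by elements killed by `δ`.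
      refine ⟨sub_eq_zero.1 (hδ _ ?_), sub_eq_zero.1 (hδ _ ?_)⟩
      · rw [map_sub, sub_sub_sub_comm]; exact sub_eq_zero.2 (hx'.trans ha'.symm)
      · rw [map_sub, sub_sub_sub_comm]; exact sub_eq_zero.2 (hy'.trans hb'.symm)
    have h1 : μ {z} * ν {0} ≤ μ {z} * ν {b} :=
      calc μ {z} * ν {0} ≤ (μ.prod ν) ({a} ×ˢ {b}) := hle.trans (measure_mono hsub)
        _ = μ {a} * ν {b} := Measure.prod_prod _ _
        _ ≤ μ {z} * ν {b} := mul_le_mul' (hmax a ha0) le_rfl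
    exact absurd h1 (not_le.2 ((ENNReal.mul_lt_mul_iff_right hμz (by finiteness)).2 (hν b hb0)))
  · have : {p : X × X | (p.1 + p.2, -(p.1 + α p.2)) ∈ ({(z, z)} : Set _)} = ∅ := by
      rw [Set.eq_empty_iff_forall_notMem]
      intro p hp
      simp only [Set.mem_ofPred_eq, Set.mem_singleton_iff, Prod.mk.injEq] at hp
      exact hex ⟨p, hp⟩
    rw [this, measure_empty] at hle
    have h0 := hν z hz
    rcases mul_eq_zero.1 (le_antisymm hle zero_le) with h' | h'
    · exact hμz h'
    · rw [h'] at h0; exact not_lt_zero h0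

omit [Countable X] in
lemma tendsto_measure_kerLevel [IsFiniteMeasure μ] (δ : X →+ X) :
    Filter.Tendsto (fun n => μ (kerLevel δ n)) Filter.atTop (nhds 0) := by
  apply ENNReal.tendsto_atTop_zero_of_tsum_ne_top
  rw [← measure_iUnion (disjoint_kerLevel δ) fun n => .of_discrete]
  finiteness

lemma HeydeSymm.measure_kerLevel_eq_zero [IsAddTorsionFree X] [IsProbabilityMeasure μ]
    [IsProbabilityMeasure ν] (h : HeydeSymm α μ ν) (hα : ∀ x, x + α x = 0 → x = 0)
    (hν : ν {0} ≠ 0) (n : ℕ) : μ (kerLevel (α - AddMonoidHom.id X) n) = 0 := by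
  set δ : X →+ X := α - AddMonoidHom.id X
  have hδ : ∀ x, δ x = α x - x := fun x => rfl
  have hcomm : ∀ n x, δ^[n] (α x + x) = α (δ^[n] x) + δ^[n] x := by
    intro n
    induction n with
    | zero => intro x; rfl
    | succ n ih =>
      intro x
      rw [Function.iterate_succ_apply, Function.iterate_succ_apply, ← ih]
      congr 1
      simp only [hδ, map_add, map_sub]
      abel
  -- If the common value `d` lies in level `n`, then so do `-2d` and `(α + 1) d`, by
  -- torsion-freeness and injectivity of `α + 1`; both coordinates of a solution therefore lie in
  -- level `n + 1`.
  have hstep : ∀ n, μ (kerLevel δ n) * ν {0} ≤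
      μ (kerLevel δ (n + 1)) * ν (kerLevel δ (n + 1)) := by
    intro n
    set S : Set (X × X) := {q | q.1 = q.2 ∧ q.1 ∈ kerLevel δ n}
    calc μ (kerLevel δ n) * ν {0}
        = (μ.prod ν) (kerLevel δ n ×ˢ {0}) := (Measure.prod_prod _ _).symm
      _ ≤ (μ.prod ν) {p | (p.1 + p.2, p.1 + α p.2) ∈ S} := by
          refine measure_mono ?_
          rintro ⟨x, y⟩ ⟨hx, hy⟩
          simp only [Set.mem_singleton_iff] at hx hy
          simp [S, hy, hx]
      _ = (μ.prod ν) {p | (p.1 + p.2, -(p.1 + α p.2)) ∈ S} := h.measure_eq S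
      _ ≤ (μ.prod ν) (kerLevel δ (n + 1) ×ˢ kerLevel δ (n + 1)) := by
          refine measure_mono ?_
          rintro ⟨x, y⟩ ⟨hxy, hmem⟩
          dsimp only at hxy hmem
          obtain ⟨hy', hx'⟩ := sub_apply_of_antidiagonal rfl hxy.symm
          obtain ⟨hm1, hm2⟩ := hmem
          refine ⟨mem_kerLevel_succ.2 ?_, mem_kerLevel_succ.2 ?_⟩
          · change δ x ∈ _
            rw [hδ, hx']
            refine ⟨by rw [hcomm, hm1]; simp, fun h0 => hm2 (hα _ ?_)⟩
            rw [hcomm] at h0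
            rw [add_comm]; exact h0
          · change δ y ∈ _
            rw [hδ, hy']
            refine ⟨by rw [iterate_map_neg, iterate_map_nsmul, hm1]; simp, fun h0 => hm2 ?_⟩
            rw [iterate_map_neg, iterate_map_nsmul, neg_eq_zero] at h0
            exact (nsmul_eq_zero_iff_right two_ne_zero).1 h0
      _ = _ := Measure.prod_prod _ _
  have hlim := tendsto_measure_kerLevel (μ := μ) δ
  obtain ⟨N, hN⟩ := Filter.eventually_atTop.1
    ((tendsto_measure_kerLevel (μ := ν) δ).eventually (gt_mem_nhds (pos_iff_ne_zero.2 hν)))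
  -- Beyond `N` the `ν`-factor is below `ν {0}` and cancels, so the level masses increase while
  -- tending to `0`.
  have hmono : ∀ k, N ≤ k → μ (kerLevel δ k) ≤ μ (kerLevel δ (k + 1)) := by
    intro k hk
    have h1 : μ (kerLevel δ k) * ν {0} ≤ μ (kerLevel δ (k + 1)) * ν {0} :=
      (hstep k).trans (mul_le_mul' le_rfl (hN (k + 1) (by omega)).le)
    exact (ENNReal.mul_le_mul_iff_left hν (by finiteness)).1 h1
  have hlarge : ∀ k, N ≤ k → μ (kerLevel δ k) = 0 := by
    intro k hk
    refine le_antisymm (ge_of_tendsto hlim ?_) zero_le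
    filter_upwards [Filter.eventually_ge_atTop k] with m hm
    induction m, hm using Nat.le_induction with
    | base => exact le_rfl
    | succ m hm ih => exact ih.trans (hmono m (hk.trans hm))
  -- `hstep` carries vanishing from level `k + 1` down to level `k`.
  have hdown : ∀ j k, N ≤ k + j → μ (kerLevel δ k) = 0 := by
    intro j
    induction j with
    | zero => exact hlarge
    | succ j ih =>
      intro k hk
      have := hstep k
      rw [ih (k + 1) (by omega), zero_mul] at this
      exact (mul_eq_zero.1 (le_antisymm this zero_le)).resolve_right hν
  exact hdown N n (by omega)

theorem HeydeSymm.exists_eq_dirac [IsAddTorsionFree X] [IsProbabilityMeasure μ]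
    [IsProbabilityMeasure ν] (h : HeydeSymm α μ ν) (hα : ∀ x, x + α x = 0 → x = 0) :
    ∃ x, μ = Measure.dirac x := by
  set δ : X →+ X := α - AddMonoidHom.id X
  have hδ : ∀ x, δ x = α x - x := fun x => rfl
  have hcomm : ∀ n x, δ^[n] (α x) = α (δ^[n] x) := by
    intro n
    induction n with
    | zero => intro x; rfl
    | succ n ih =>
      intro x
      rw [Function.iterate_succ_apply, Function.iterate_succ_apply, ← ih]
      congr 1
      simp only [hδ, map_sub]
  let Z := X ⧸ kerUnion δ
  have : IsAddTorsionFree Z := isAddTorsionFree_quotient_kerUnion δ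
  let π : X →+ Z := QuotientAddGroup.mk' (kerUnion δ)
  have hπ : Function.Surjective π := QuotientAddGroup.mk'_surjective _
  have : Countable Z := hπ.countable
  have hker : ∀ x, π x = 0 ↔ x ∈ kerUnion δ := fun x => QuotientAddGroup.eq_zero_iff x
  let β : Z →+ Z := QuotientAddGroup.map _ _ α (by
    rintro x ⟨n, hn⟩
    exact ⟨n, by rw [hcomm, hn, map_zero]⟩)
  have hβ : ∀ x, β (π x) = π (α x) := fun x => rfl
  let _ : MeasurableSpace Z := ⊤
  have : IsProbabilityMeasure (μ.map π) :=
    Measure.isProbabilityMeasure_map (Measurable.of_discrete).aemeasurable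
  have : IsProbabilityMeasure (ν.map π) :=
    Measure.isProbabilityMeasure_map (Measurable.of_discrete).aemeasurable
  have hβ1 : ∀ z, z + β z = 0 → z = 0 := by
    intro z
    obtain ⟨x, rfl⟩ := hπ z
    rw [hβ, ← map_add, hker, hker]
    rintro ⟨n, hn⟩
    exact ⟨n, hα _ (by rw [← hcomm, ← iterate_map_add, hn])⟩
  have hβ2 : ∀ z, β z - z = 0 → z = 0 := by
    intro z
    obtain ⟨x, rfl⟩ := hπ z
    rw [hβ, ← map_sub, hker, hker]
    rintro ⟨n, hn⟩
    exact ⟨n + 1, hn⟩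
  have hquot : ∀ z : Z, z ≠ 0 → symmetrization (μ.map π) {z} = 0 := fun z hz =>
    (h.map π hβ).symmetrized.singleton_eq_zero_of_injective hβ1 hβ2
      (fun b hb => symmetrization_singleton_lt _ hb) hz
  by_cases htriv : ∃ x : X, x ≠ 0
  -- The trivial group is separate: positivity of `ν`'s atom at `0` is read off from a comparison
  -- with a nonzero point.
  swap
  · push Not at htriv
    refine exists_eq_dirac_of_symmetrization μ ?_
    rw [show ({0} : Set X) = Set.univ from Set.eq_univ_of_forall htriv, measure_univ]
  obtain ⟨x₀, hx₀⟩ := htriv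
  have hν0 : symmetrization ν {0} ≠ 0 := (pos_of_gt (symmetrization_singleton_lt ν hx₀)).ne'
  have hzero : ∀ x, x ≠ 0 → symmetrization μ {x} = 0 := by
    intro x hx
    by_cases hxk : x ∈ kerUnion δ
    · obtain ⟨n, hn⟩ := hxk
      obtain ⟨m, hm⟩ := exists_mem_kerLevel hn hx
      exact measure_mono_null (Set.singleton_subset_iff.2 hm)
        (h.symmetrized.measure_kerLevel_eq_zero hα hν0 m)
    · have := hquot (π x) fun h0 => hxk ((hker x).1 h0)
      rw [symmetrization_map, Measure.map_apply .of_discrete .of_discrete] at this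
      exact measure_mono_null (by simp) this
  refine exists_eq_dirac_of_symmetrization μ ?_
  rw [← prob_compl_eq_zero_iff .of_discrete, ← Set.biUnion_of_singleton ({0}ᶜ : Set X)]
  exact (measure_biUnion_null_iff (Set.to_countable _)).2 fun x hx => hzero x hx

end Degeneracy
-- From conditional symmetry to the identity of laws, and uniqueness of Fourier transforms.
open scoped BoundedContinuousFunction

lemma CondDistribSymmetric.map_prodMk_eq {Ω S T : Type*} [MeasurableSpace Ω] [MeasurableSpace S]
    [MeasurableSpace T] [StandardBorelSpace T] [AddGroup T] [MeasurableNeg T]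
    {P : Measure Ω} [IsFiniteMeasure P] {L₂ : Ω → T} {L₁ : Ω → S}
    (h₁ : Measurable L₁) (h₂ : Measurable L₂) (h : CondDistribSymmetric P L₂ L₁) :
    P.map (fun ω => (L₁ ω, L₂ ω)) = P.map (fun ω => (L₁ ω, -L₂ ω)) := by
  have hmap : P.map (fun ω => (L₁ ω, -L₂ ω)) =
      (P.map (fun ω => (L₁ ω, L₂ ω))).map (fun q => (q.1, -q.2)) := by
    rw [Measure.map_map (by fun_prop) (by fun_prop)]
    rfl
  rw [hmap, ← compProd_map_condDistrib h₂.aemeasurable]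
  refine Measure.ext_of_lintegral _ fun f hf => ?_
  rw [lintegral_map hf (by fun_prop), Measure.lintegral_compProd hf,
    Measure.lintegral_compProd (by fun_prop)]
  refine lintegral_congr_ae ?_
  filter_upwards [h] with s hs
  rw [← lintegral_map (μ := condDistrib L₂ L₁ P s) (f := fun t => f (s, t)) (by fun_prop)
    measurable_neg]
  exact congrArg (fun m => ∫⁻ t, f (s, t) ∂m) hs.symm

lemma heydeSymm_of_condDistribSymmetric {X Ω : Type*} [AddCommGroup X] [Countable X]
    [MeasurableSpace X] [DiscreteMeasurableSpace X] [MeasurableSpace Ω]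
    {P : Measure Ω} [IsProbabilityMeasure P] (α : X ≃+ X) {ξ₁ ξ₂ : Ω → X} (h₁ : Measurable ξ₁) (h₂ : Measurable ξ₂) (hind : IndepFun ξ₁ ξ₂ P)
    (h : CondDistribSymmetric P (fun ω => ξ₁ ω + α (ξ₂ ω)) (fun ω => ξ₁ ω + ξ₂ ω)) :
    HeydeSymm (α : X →+ X) (P.map ξ₁) (P.map ξ₂) := by
  rw [HeydeSymm, ← (indepFun_iff_map_prod_eq_prod_map_map h₁.aemeasurable h₂.aemeasurable).1 hind,
    Measure.map_map .of_discrete (by fun_prop), Measure.map_map .of_discrete (by fun_prop)]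
  have hm : Measurable fun ω => α (ξ₂ ω) := (Measurable.of_discrete (f := α)).comp h₂
  exact h.map_prodMk_eq (h₁.add h₂) (h₁.add hm)

theorem HeydeSymm.isDegenerate {X : Type*} [AddCommGroup X] [IsAddTorsionFree X]
    [Countable X] [MeasurableSpace X] [DiscreteMeasurableSpace X] {α : X ≃+ X}
    {μ ν : Measure X} [IsProbabilityMeasure μ] [IsProbabilityMeasure ν]
    (h : HeydeSymm (α : X →+ X) μ ν) (hα : ∀ x : X, x + α x = 0 → x = 0) :
    IsDegenerate μ ∧ IsDegenerate ν := by
  refine ⟨h.exists_eq_dirac hα, (h.swap α).exists_eq_dirac fun x hx => ?_⟩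
  have hx' : x + α.symm x = 0 := hx
  have : α.symm x = 0 := hα _ (by rw [add_comm]; simpa using hx')
  simpa using this

/-- Finite measures on a countable discrete space are determined by their integrals against a
separating group of circle-valued functions. -/
lemma ext_of_forall_integral_circle_eq {E W : Type*} [Countable E] [MeasurableSpace E]
    [DiscreteMeasurableSpace E] [CommGroup W] (φ : W →* (E → Circle))
    (hφ : ∀ x y, (∀ w, φ w x = φ w y) → x = y) {P Q : Measure E} [IsFiniteMeasure P]
    [IsFiniteMeasure Q] (h : ∀ w, ∫ x, (φ w x : ℂ) ∂P = ∫ x, (φ w x : ℂ) ∂Q) : P = Q := by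
  let _ : TopologicalSpace E := ⊥
  have : DiscreteTopology E := ⟨rfl⟩
  let f : W →* (E →ᵇ ℂ) :=
    { toFun w := BoundedContinuousFunction.ofNormedAddCommGroupDiscrete
        (fun x => (φ w x : ℂ)) 1 (fun x => (Circle.norm_coe _).le)
      map_one' := by ext; simp
      map_mul' a b := by ext; simp }
  have hf : ∀ w x, f w x = (φ w x : ℂ) := fun _ _ => rfl
  have hstar : ∀ w, star (f w) = f w⁻¹ := by
    intro w
    ext x
    rw [BoundedContinuousFunction.star_apply, hf, hf, map_inv, Pi.inv_apply,
      Circle.coe_inv_eq_conj]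
    rfl
  refine ext_of_forall_mem_subalgebra_integral_eq_of_polish (𝕜 := ℂ)
    (A := StarAlgebra.adjoin ℂ (Set.range f)) ?_ ?_
  · intro x y hxy
    obtain ⟨w, hw⟩ : ∃ w, φ w x ≠ φ w y := by
      by_contra! hne
      exact hxy (hφ x y hne)
    refine ⟨f w, ⟨BoundedContinuousFunction.toContinuousMapStarₐ ℂ (f w),
      ⟨f w, StarAlgebra.subset_adjoin ℂ _ ⟨w, rfl⟩, rfl⟩, rfl⟩, fun heq => hw ?_⟩
    exact Circle.ext heq
  · intro g hg
    -- The functions `f w` are closed under products and conjugation, so the star algebra they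
    -- generate is just their linear span.
    have hspan : g ∈ Submodule.span ℂ (Set.range f) := by
      have hs : star (Set.range f) = Set.range f := by
        ext k
        constructor
        · rintro ⟨w, hw⟩
          exact ⟨w⁻¹, by rw [← hstar, hw, star_star]⟩
        · rintro ⟨w, rfl⟩
          exact ⟨w⁻¹, by rw [← hstar]⟩
      have : g ∈ Algebra.adjoin ℂ (Set.range f) := by
        rw [← StarSubalgebra.mem_toSubalgebra, StarAlgebra.adjoin_toSubalgebra, hs,
          Set.union_self] at hg
        exact hg
      rw [← Subalgebra.mem_toSubmodule, Algebra.adjoin_eq_span, ← MonoidHom.coe_mrange,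
        Submonoid.closure_eq] at this
      exact this
    clear hg
    induction hspan using Submodule.span_induction with
    | mem k hk =>
      obtain ⟨w, rfl⟩ := hk
      exact h w
    | zero => simp
    | add k l _ _ hk hl =>
      simp only [BoundedContinuousFunction.coe_add, Pi.add_apply]
      rw [integral_add (k.integrable P) (l.integrable P),
        integral_add (k.integrable Q) (l.integrable Q), hk, hl]
    | smul c k _ hk =>
      simp only [BoundedContinuousFunction.coe_smul]
      rw [integral_smul, integral_smul, hk]

/-! ### Character groups and the dual formulation. -/

section Dual

variable {Y : Type*} [AddCommGroup Y] [TopologicalSpace Y]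

@[simp]
lemma charValue_mul_left (x x' : CharGroup Y) (y : Y) :
    charValue (x * x') y = charValue x y * charValue x' y := rfl

lemma charValue_add (x : CharGroup Y) (y y' : Y) :
    charValue x (y + y') = charValue x y * charValue x y' := by
  simp [charValue]

lemma charGroup_pow_apply (x : CharGroup Y) (n : ℕ) (y : Multiplicative Y) :
    (x ^ n) y = x y ^ n := by
  induction n with
  | zero => simp
  | succ n ih =>
    rw [pow_succ, pow_succ, ← ih]
    rfl

/-- If `x ^ n = x' ^ n`, the quotient character takes values in the finite set of `n`-th roots of
unity, so it is constant on a connected group. -/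
lemma isMulTorsionFree_charGroup [ConnectedSpace Y] : IsMulTorsionFree (CharGroup Y) where
  pow_left_injective n hn := by
    intro x x' hxx'
    have hpow : ∀ y, (x * x'⁻¹) y ^ n = 1 := by
      intro y
      have : (x * x'⁻¹) ^ n = 1 := by
        rw [mul_pow, inv_pow, show x ^ n = x' ^ n from hxx', mul_inv_cancel]
      rw [← charGroup_pow_apply, this, PontryaginDual.one_apply]
    have hfin : (Set.range fun y : Y => charValue (x * x'⁻¹) y).Finite := by
      refine (Polynomial.nthRootsFinset n (1 : ℂ)).finite_toSet.subset ?_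
      rintro _ ⟨y, rfl⟩
      rw [Finset.mem_coe, Polynomial.mem_nthRootsFinset (Nat.pos_of_ne_zero hn)]
      exact congrArg (fun z : Circle => (z : ℂ)) (hpow (Multiplicative.ofAdd y))
    have hcont : Continuous fun y : Y => charValue (x * x'⁻¹) y :=
      continuous_subtype_val.comp ((map_continuous (x * x'⁻¹)).comp continuous_ofAdd)
    have hsub : (Set.range fun y : Y => charValue (x * x'⁻¹) y).Subsingleton := by
      by_contra hne
      exact (isPreconnected_range hcont).infinite_of_nontrivial
        (Set.not_subsingleton_iff.1 hne) hfin
    rw [← mul_inv_eq_one]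
    refine PontryaginDual.ext fun y => Circle.ext ?_
    have := hsub ⟨y.toAdd, rfl⟩ ⟨0, rfl⟩
    have h0 : charValue (x * x'⁻¹) (0 : Y) = 1 := by simp [charValue]
    exact this.trans h0

/-- The dual of a compact group is discrete, and it inherits second countability from the space of
continuous maps to the circle. -/
lemma countable_charGroup [IsTopologicalAddGroup Y] [CompactSpace Y]
    [SecondCountableTopology Y] : Countable (CharGroup Y) := by
  have : SecondCountableTopology (Multiplicative Y) :=
    inferInstanceAs (SecondCountableTopology Y)
  have : SecondCountableTopology (Multiplicative Y →ₜ* Circle) :=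
    (ContinuousMonoidHom.isInducing_toContinuousMap (Multiplicative Y)
      Circle).secondCountableTopology
  have : SecondCountableTopology (CharGroup Y) := this
  exact TopologicalSpace.separableSpace_iff_countable.1 inferInstance

/-- The automorphism `x ↦ x ∘ β` of the character group, written additively. -/
noncomputable def charGroupCongr (β : Y ≃ₜ+ Y) : Additive (CharGroup Y) ≃+ Additive (CharGroup Y) where
  toFun x := Additive.ofMul (PontryaginDual.map
    { toFun := fun y : Multiplicative Y => Multiplicative.ofAdd (β y.toAdd)
      map_one' := map_zero β
      map_mul' := map_add β
      continuous_toFun := β.continuous } x.toMul)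
  invFun x := Additive.ofMul (PontryaginDual.map
    { toFun := fun y : Multiplicative Y => Multiplicative.ofAdd (β.symm y.toAdd)
      map_one' := map_zero β.symm
      map_mul' := map_add β.symm
      continuous_toFun := β.symm.continuous } x.toMul)
  left_inv x := Additive.toMul.injective <| PontryaginDual.ext fun y =>
    congrArg x.toMul (congrArg Multiplicative.ofAdd (β.apply_symm_apply y.toAdd))
  right_inv x := Additive.toMul.injective <| PontryaginDual.ext fun y =>
    congrArg x.toMul (congrArg Multiplicative.ofAdd (β.symm_apply_apply y.toAdd))
  map_add' _ _ := rfl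

lemma charValue_charGroupCongr (β : Y ≃ₜ+ Y) (x : Additive (CharGroup Y)) (y : Y) :
    charValue (charGroupCongr β x).toMul y = charValue x.toMul (β y) := rfl

/-- The hypothesis says that `x` is trivial on the range of `I + β`, which is all of `Y`. -/
lemma charGroupCongr_add_self_injective (β : Y ≃ₜ+ Y)
    (hβ : Set.range (fun y : Y => y + β y) = Set.univ) (x : Additive (CharGroup Y))
    (hx : x + charGroupCongr β x = 0) : x = 0 := by
  refine Additive.toMul.injective (PontryaginDual.ext fun y => Circle.ext ?_)
  obtain ⟨z, hz⟩ := hβ.symm ▸ Set.mem_univ y.toAdd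
  have h := congrArg (fun w : Additive (CharGroup Y) => charValue w.toMul z) hx
  simp only [toMul_add, charValue_mul_left, charValue_charGroupCongr, ← charValue_add, hz] at h
  exact h

/-- The pairing of `Y × Y` with the square of the character group. -/
noncomputable def pairChar : Multiplicative (Y × Y) →*
    (Additive (CharGroup Y) × Additive (CharGroup Y) → Circle) where
  toFun w q := q.1.toMul (Multiplicative.ofAdd w.toAdd.1) *
    q.2.toMul (Multiplicative.ofAdd w.toAdd.2)
  map_one' := by ext; simp
  map_mul' w w' := by ext; simp; ring

lemma coe_pairChar (u v : Y) (q : Additive (CharGroup Y) × Additive (CharGroup Y)) :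
    (pairChar (Multiplicative.ofAdd (u, v)) q : ℂ) =
      charValue q.1.toMul u * charValue q.2.toMul v := rfl

section Measure

variable [MeasurableSpace (CharGroup Y)] [DiscreteMeasurableSpace (CharGroup Y)]
  [MeasurableSpace (Additive (CharGroup Y))] [DiscreteMeasurableSpace (Additive (CharGroup Y))]

lemma charFunction_eq_integral_map_ofMul (μ : Measure (CharGroup Y)) (y : Y) :
    charFunction μ y = ∫ x, charValue x.toMul y ∂(μ.map Additive.ofMul) := by
  rw [integral_map (Measurable.of_discrete).aemeasurable
    (Measurable.of_discrete).aestronglyMeasurable]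
  rfl

lemma charFunction_eq_charValue_of_isDegenerate {μ : Measure (CharGroup Y)}
    (h : IsDegenerate (μ.map (Additive.ofMul : _ → Additive (CharGroup Y)))) :
    ∃ x : CharGroup Y, ∀ y : Y, charFunction μ y = charValue x y := by
  obtain ⟨x, hx⟩ := h
  exact ⟨x.toMul, fun y => by rw [charFunction_eq_integral_map_ofMul, hx, integral_dirac]⟩

variable [Countable (CharGroup Y)]

lemma integral_pairChar (β : Y ≃ₜ+ Y) (μ₁ μ₂ : Measure (CharGroup Y))
    [IsProbabilityMeasure μ₁] [IsProbabilityMeasure μ₂] (u v : Y) :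
    ∫ p, (pairChar (Multiplicative.ofAdd (u, v)) (p.1 + p.2, p.1 + charGroupCongr β p.2) : ℂ)
      ∂((μ₁.map Additive.ofMul).prod (μ₂.map Additive.ofMul)) =
      charFunction μ₁ (u + v) * charFunction μ₂ (u + β v) := by
  rw [charFunction_eq_integral_map_ofMul, charFunction_eq_integral_map_ofMul, ← integral_prod_mul]
  refine integral_congr_ae (Filter.Eventually.of_forall fun p => ?_)
  simp only [coe_pairChar, toMul_add, charValue_mul_left, charValue_charGroupCongr, charValue_add]
  ring

/-- The two sides of the functional equation are the Fourier transform of the law of the two forms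
at `(u, v)` and at `(u, -v)`; the latter is the transform at `(u, v)` after negating the second
form. -/
lemma heydeSymm_of_charFunction (β : Y ≃ₜ+ Y) (μ₁ μ₂ : Measure (CharGroup Y))
    [IsProbabilityMeasure μ₁] [IsProbabilityMeasure μ₂]
    (h : ∀ u v : Y, charFunction μ₁ (u + v) * charFunction μ₂ (u + β v) =
      charFunction μ₁ (u - v) * charFunction μ₂ (u - β v)) :
    HeydeSymm (charGroupCongr β : Additive (CharGroup Y) →+ Additive (CharGroup Y))
      (μ₁.map Additive.ofMul) (μ₂.map Additive.ofMul) := by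
  have : Countable (Additive (CharGroup Y)) := ‹Countable (CharGroup Y)›
  have : IsProbabilityMeasure (μ₁.map (Additive.ofMul : _ → Additive (CharGroup Y))) :=
    Measure.isProbabilityMeasure_map (Measurable.of_discrete).aemeasurable
  have : IsProbabilityMeasure (μ₂.map (Additive.ofMul : _ → Additive (CharGroup Y))) :=
    Measure.isProbabilityMeasure_map (Measurable.of_discrete).aemeasurable
  refine ext_of_forall_integral_circle_eq pairChar ?_ fun w => ?_
  · intro q q' hq
    refine Prod.ext (Additive.toMul.injective (PontryaginDual.ext fun y => ?_))
      (Additive.toMul.injective (PontryaginDual.ext fun y => ?_))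
    · simpa [pairChar] using hq (Multiplicative.ofAdd (y.toAdd, 0))
    · simpa [pairChar] using hq (Multiplicative.ofAdd (0, y.toAdd))
  · obtain ⟨u, v⟩ := w
    rw [integral_map (Measurable.of_discrete).aemeasurable
      (Measurable.of_discrete).aestronglyMeasurable,
      integral_map (Measurable.of_discrete).aemeasurable
      (Measurable.of_discrete).aestronglyMeasurable]
    have hneg : ∀ s t : Additive (CharGroup Y), pairChar (Multiplicative.ofAdd (u, v)) (s, -t) =
        pairChar (Multiplicative.ofAdd (u, -v)) (s, t) := by
      intro s t
      simp only [pairChar]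
      simp
      rfl
    refine (integral_pairChar β μ₁ μ₂ u v).trans ((h u v).trans ?_)
    have := integral_pairChar β μ₁ μ₂ u (-v)
    rw [map_neg, ← sub_eq_add_neg, ← sub_eq_add_neg] at this
    rw [← this]
    refine integral_congr_ae (Filter.Eventually.of_forall fun p => ?_)
    exact congrArg _ (hneg _ _).symm

end Measure

end Dual

theorem lemma4 :
    (∀ {X Ω : Type*} [AddCommGroup X] [IsAddTorsionFree X] [Countable X]
        [TopologicalSpace X] [DiscreteTopology X] [MeasurableSpace X] [BorelSpace X]
        [MeasurableSpace Ω] (P : Measure Ω) [IsProbabilityMeasure P]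
        (α : X ≃+ X) (_ : ∀ x : X, x + α x = 0 → x = 0)
        (ξ₁ ξ₂ : Ω → X) (_ : Measurable ξ₁) (_ : Measurable ξ₂) (_ : IndepFun ξ₁ ξ₂ P)
        (μ₁ μ₂ : Measure X) (_ : P.map ξ₁ = μ₁) (_ : P.map ξ₂ = μ₂)
        (_ : CondDistribSymmetric P (fun ω => ξ₁ ω + α (ξ₂ ω)) (fun ω => ξ₁ ω + ξ₂ ω)),
        IsDegenerate μ₁ ∧ IsDegenerate μ₂) ∧
    (∀ {Y : Type*} [AddCommGroup Y] [TopologicalSpace Y] [IsTopologicalAddGroup Y]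
        [CompactSpace Y] [ConnectedSpace Y] [T2Space Y] [SecondCountableTopology Y]
        [MeasurableSpace (CharGroup Y)] [BorelSpace (CharGroup Y)]
        (β : Y ≃ₜ+ Y) (_ : Set.range (fun y : Y => y + β y) = Set.univ)
        (μ₁ μ₂ : Measure (CharGroup Y)) [IsProbabilityMeasure μ₁] [IsProbabilityMeasure μ₂]
        (_ : ∀ u v : Y,
          charFunction μ₁ (u + v) * charFunction μ₂ (u + β v) =
            charFunction μ₁ (u - v) * charFunction μ₂ (u - β v)),
        (∃ x₁ : CharGroup Y, ∀ y : Y, charFunction μ₁ y = charValue x₁ y) ∧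
          (∃ x₂ : CharGroup Y, ∀ y : Y, charFunction μ₂ y = charValue x₂ y)) := by
  refine ⟨?_, ?_⟩
  · intro X Ω _ _ _ _ _ _ _ _ P _ α hα ξ₁ ξ₂ h₁ h₂ hind μ₁ μ₂ hμ₁ hμ₂ h
    subst hμ₁ hμ₂
    have := Measure.isProbabilityMeasure_map (μ := P) h₁.aemeasurable
    have := Measure.isProbabilityMeasure_map (μ := P) h₂.aemeasurable
    exact (heydeSymm_of_condDistribSymmetric α h₁ h₂ hind h).isDegenerate hα
  · intro Y _ _ _ _ _ _ _ _ _ β hβ μ₁ μ₂ _ _ h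
    have : Countable (CharGroup Y) := countable_charGroup
    have : IsMulTorsionFree (CharGroup Y) := isMulTorsionFree_charGroup
    have : Countable (Additive (CharGroup Y)) := ‹Countable (CharGroup Y)›
    let _ : MeasurableSpace (Additive (CharGroup Y)) := ⊤
    have : IsProbabilityMeasure (μ₁.map (Additive.ofMul : _ → Additive (CharGroup Y))) :=
      Measure.isProbabilityMeasure_map (Measurable.of_discrete).aemeasurable
    have : IsProbabilityMeasure (μ₂.map (Additive.ofMul : _ → Additive (CharGroup Y))) :=
      Measure.isProbabilityMeasure_map (Measurable.of_discrete).aemeasurable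
    obtain ⟨hd₁, hd₂⟩ := (heydeSymm_of_charFunction β μ₁ μ₂ h).isDegenerate
      (charGroupCongr_add_self_injective β hβ)
    exact ⟨charFunction_eq_charValue_of_isDegenerate hd₁,
      charFunction_eq_charValue_of_isDegenerate hd₂⟩
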